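/- Let $n\ge 3$, let $\Omega\subset\mathbb R^n$ be a bounded domain of class $C^1$, and let $q=\frac{2n}{n-2}$. Let $p\in H^1(\Omega)\cap C(\overline\Omega)$ satisfy $0<c_1\le p(x)\le c_2$ for all $x\in\overline\Omega$, and let $g\in H^{1/2}(\partial\Omega)\cap C(\partial\Omega)$. Write $\|\cdot\|_q$ for the norm of $L^q(\Omega)$, and for a boundary datum $h$ put $$H^1_h(\Omega)=\{u\in H^1(\Omega): u=h \text{ on }\partial\Omega \text{ in the sense of traces}\},\qquad \Sigma_h=\{u\in H^1_h(\Omega):\|u\|_q=1\}.$$ Let $v\in H^1_g(\Omega)$ be the weak solution of $-\operatorname{div}(p\nabla v)=0$ in $\Omega$, $v=g$ on $\partial\Omega$. 1. If $\|v\|_q<1$, then for every $u\in\Sigma_0$ there is exactly one real number $t(u)>0$ with $\|t(u)u+v\|_q=1$, and the map $u\mapsto t(u)u+v$ is a bijection from $\Sigma_0$ onto $\Sigma_g$. 2. If $\|v\|_q\ge 1$, then $\Sigma_g\neq\emptyset$. -/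

import Mathlib

open MeasureTheory Filter Topology
open scoped ENNReal ContDiff

noncomputable section

namespace CritSob

/-- Euclidean space `ℝⁿ`. -/
abbrev Eucl (n : ℕ) : Type := EuclideanSpace ℝ (Fin n)

/-- `L²(Ω)`: almost-everywhere classes of real square-integrable functions on `Ω`. -/
abbrev L2 {n : ℕ} (Ω : Set (Eucl n)) : Type := Lp ℝ 2 (volume.restrict Ω)

/-- `L²(Ω; ℝⁿ)`: square-integrable vector fields on `Ω`. -/
abbrev L2Vec {n : ℕ} (Ω : Set (Eucl n)) : Type := Lp (Eucl n) 2 (volume.restrict Ω)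

/-- The boundary of `Ω` is of class `C¹`: near each boundary point, and after a choice of a unit
vector `e` as vertical direction, `Ω` is the set of points lying strictly above the graph of a
`C¹` function defined on the hyperplane `e^⊥`. -/
def HasC1Boundary {n : ℕ} (Ω : Set (Eucl n)) : Prop :=
  ∀ x₀ ∈ frontier Ω, ∃ r : ℝ, 0 < r ∧ ∃ e : Eucl n, ‖e‖ = 1 ∧
    ∃ γ : ((Submodule.span ℝ {e})ᗮ : Submodule ℝ (Eucl n)) → ℝ, ContDiff ℝ 1 γ ∧
      ∀ x ∈ Metric.ball x₀ r,
        (x ∈ Ω ↔ γ ((Submodule.span ℝ {e})ᗮ.orthogonalProjectionOnto x) < inner ℝ e x)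

/-- Bounded domain (nonempty connected open set) of class `C¹`. -/
structure IsBoundedC1Domain {n : ℕ} (Ω : Set (Eucl n)) : Prop where
  isOpen : IsOpen Ω
  isConnected : IsConnected Ω
  isBounded : Bornology.IsBounded Ω
  c1Boundary : HasC1Boundary Ω

/-- `φ ∈ C_c^∞(Ω)`. -/
structure IsTestFunction {n : ℕ} (Ω : Set (Eucl n)) (φ : Eucl n → ℝ) : Prop where
  smooth : ContDiff ℝ ∞ φ
  compactSupport : HasCompactSupport φ
  support_subset : tsupport φ ⊆ Ω

/-- `G` is the weak gradient of `u` in `Ω`: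
`∫_Ω u ∇φ = - ∫_Ω φ G` for every `φ ∈ C_c^∞(Ω)`. -/
def IsWeakGradient {n : ℕ} {Ω : Set (Eucl n)} (u : L2 Ω) (G : L2Vec Ω) : Prop :=
  ∀ φ : Eucl n → ℝ, IsTestFunction Ω φ →
    ∫ x in Ω, u x • gradient φ x = - ∫ x in Ω, φ x • G x

/-- The Sobolev space `H¹(Ω)`, as a set of elements of `L²(Ω)`. -/
def H1 {n : ℕ} (Ω : Set (Eucl n)) : Set (L2 Ω) :=
  {u | ∃ G : L2Vec Ω, IsWeakGradient u G}

/-- Surface measure on `∂Ω`: the `(n-1)`-dimensional Hausdorff measure restricted to `∂Ω`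
(the normalising constant is irrelevant for what follows). -/
def surfaceMeasure {n : ℕ} (Ω : Set (Eucl n)) : Measure (Eucl n) :=
  (Measure.hausdorffMeasure ((n : ℝ) - 1)).restrict (frontier Ω)

/-- `u ∈ H¹(Ω)` and `u = g` on `∂Ω` in the sense of traces. The trace operator is the continuous
extension to `H¹(Ω)` of the restriction map `φ ↦ φ|_∂Ω`, defined on functions smooth up to the
boundary and with values in `L²(∂Ω)`; so the trace of `u` is `g` when there are smooth `φ k` with
`φ k → u` in `H¹(Ω)` and `φ k → g` in `L²(∂Ω)`. -/
def HasTrace {n : ℕ} {Ω : Set (Eucl n)} (u : L2 Ω) (g : Eucl n → ℝ) : Prop :=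
  ∃ G : L2Vec Ω, IsWeakGradient u G ∧ ∃ φ : ℕ → Eucl n → ℝ,
    (∀ k, ContDiff ℝ ∞ (φ k)) ∧
    Tendsto (fun k => eLpNorm (fun x => φ k x - u x) 2 (volume.restrict Ω)) atTop (𝓝 0) ∧
    Tendsto (fun k => eLpNorm (fun x => gradient (φ k) x - G x) 2 (volume.restrict Ω))
      atTop (𝓝 0) ∧
    Tendsto (fun k => eLpNorm (fun x => φ k x - g x) 2 (surfaceMeasure Ω)) atTop (𝓝 0)

/-- `H¹_g(Ω) = {u ∈ H¹(Ω) : u = g on ∂Ω}`. -/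
def H1g {n : ℕ} (Ω : Set (Eucl n)) (g : Eucl n → ℝ) : Set (L2 Ω) :=
  {u | u ∈ H1 Ω ∧ HasTrace u g}

/-- `g ∈ H^{1/2}(∂Ω)`: `g ∈ L²(∂Ω)` and its Gagliardo seminorm
`∬ |g(x) - g(y)|² / |x - y|ⁿ dσ(x) dσ(y)` is finite. -/
def MemHHalf {n : ℕ} (Ω : Set (Eucl n)) (g : Eucl n → ℝ) : Prop :=
  MemLp g 2 (surfaceMeasure Ω) ∧
    ∫⁻ x, ∫⁻ y, edist (g x) (g y) ^ 2 / edist x y ^ n ∂(surfaceMeasure Ω) ∂(surfaceMeasure Ω) < (⊤ : ℝ≥0∞)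

/-- `v` is a weak solution of `-div(p ∇v) = 0` in `Ω`, `v = g` on `∂Ω`. -/
def IsDirichletSolution {n : ℕ} (Ω : Set (Eucl n)) (p g : Eucl n → ℝ) (v : L2 Ω) : Prop :=
  v ∈ H1g Ω g ∧ ∃ G : L2Vec Ω, IsWeakGradient v G ∧
    ∀ φ : Eucl n → ℝ, IsTestFunction Ω φ → ∫ x in Ω, p x * inner ℝ (G x) (gradient φ x) = 0

/-- The norm `‖u‖_q` on `Ω` for the critical Sobolev exponent `q = 2n/(n-2)`,
with value `∞` if `u ∉ L^q(Ω)`. -/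
def critNorm {n : ℕ} {Ω : Set (Eucl n)} (u : L2 Ω) : ℝ≥0∞ :=
  eLpNorm u (ENNReal.ofReal (2 * (n : ℝ) / ((n : ℝ) - 2))) (volume.restrict Ω)

/-- `Σ_g = {u ∈ H¹_g(Ω) : ‖u‖_q = 1}`. -/
def SigmaSet {n : ℕ} (Ω : Set (Eucl n)) (g : Eucl n → ℝ) : Set (L2 Ω) :=
  {u | u ∈ H1g Ω g ∧ critNorm u = 1}

end CritSob

end

/-!
Both parts rest on one fact about normed spaces: a ray issuing from a point of the open unit ball
meets the unit sphere exactly once (`exists_unique_norm_smul_add_eq_one`), since the norm is convex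
and tends to infinity along the ray.

If `‖v‖_q < 1`, this fact, applied in `L^q(Ω)` to the ray `t ↦ t u + v`, gives `t(u)`. The map
`u ↦ t(u) u + v` preserves the boundary condition because traces are linear, its inverse is
`w ↦ (w - v) / ‖w - v‖_q`, and `w - v` has positive norm because `‖v‖_q < 1 = ‖w‖_q`.

For `Σ_g ≠ ∅` it suffices to find some `w ∈ H¹_g(Ω)` with `‖w‖_q < 1`, because the ray from `w` in
the direction of a bump function supported in `Ω` then meets the unit sphere. Since `g` is
continuous on the compact set `∂Ω`, it is bounded, and `v` may be replaced by `T ∘ v`, where `T` is a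
bounded smooth function equal to the identity on the range of `g`; this changes neither the
membership in `H¹(Ω)` nor the trace (`exists_bounded_mem_H1g`). Multiplying the bounded function so
obtained by a cutoff equal to one on `∂Ω` and vanishing on a compact subset of `Ω` of nearly full
measure keeps the trace and makes the `L^q` norm as small as desired
(`exists_mem_H1g_critNorm_lt_one`). Boundedness of the truncated function thus replaces the Sobolev
embedding.

Traces are handled through approximation by functions smooth on `ℝⁿ`: the weak gradient is closed
(`isWeakGradient_of_tendsto`), so membership in `H¹_g(Ω)` follows once smooth approximations
converge together with their gradients and their boundary values (`toLp_mem_H1g`).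
-/

namespace CritSob

variable {n : ℕ} {Ω : Set (Eucl n)}

/-! ### Gradients of smooth functions -/

theorem continuous_gradient {φ : Eucl n → ℝ} (hφ : ContDiff ℝ ∞ φ) : Continuous (gradient φ) :=
  (InnerProductSpace.toDual ℝ (Eucl n)).symm.continuous.comp
    (hφ.continuous_fderiv (by simp))

theorem hasGradientAt_of_contDiff {φ : Eucl n → ℝ} (hφ : ContDiff ℝ ∞ φ) (x : Eucl n) :
    HasGradientAt φ (gradient φ x) x :=
  (hφ.differentiable (by simp) x).hasGradientAt

theorem hasCompactSupport_gradient {φ : Eucl n → ℝ} (hφ : HasCompactSupport φ) :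
    HasCompactSupport (gradient φ) :=
  (hφ.fderiv ℝ).comp_left (g := (InnerProductSpace.toDual ℝ (Eucl n)).symm) (map_zero _)

theorem gradient_eq_zero_of_notMem_tsupport {φ : Eucl n → ℝ} {x : Eucl n} (hx : x ∉ tsupport φ) :
    gradient φ x = 0 := by
  rw [gradient, fderiv_of_notMem_tsupport ℝ hx, map_zero]

theorem gradient_add {φ ψ : Eucl n → ℝ} (hφ : ContDiff ℝ ∞ φ) (hψ : ContDiff ℝ ∞ ψ)
    (x : Eucl n) : gradient (fun y => φ y + ψ y) x = gradient φ x + gradient ψ x := by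
  rw [gradient, fderiv_fun_add (hφ.differentiable (by simp) x) (hψ.differentiable (by simp) x)]
  simp [gradient]

theorem gradient_mul {φ ψ : Eucl n → ℝ} (hφ : ContDiff ℝ ∞ φ) (hψ : ContDiff ℝ ∞ ψ)
    (x : Eucl n) :
    gradient (fun y => φ y * ψ y) x = φ x • gradient ψ x + ψ x • gradient φ x := by
  rw [gradient, fderiv_fun_mul (hφ.differentiable (by simp) x) (hψ.differentiable (by simp) x)]
  simp [gradient]

theorem gradient_const_mul {φ : Eucl n → ℝ} (hφ : ContDiff ℝ ∞ φ) (c : ℝ) (x : Eucl n) :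
    gradient (fun y => c * φ y) x = c • gradient φ x := by
  simpa using gradient_mul (φ := fun _ => c) contDiff_const hφ x

theorem gradient_comp {T : ℝ → ℝ} {φ : Eucl n → ℝ} (hT : ContDiff ℝ ∞ T) (hφ : ContDiff ℝ ∞ φ)
    (x : Eucl n) : gradient (fun y => T (φ y)) x = deriv T (φ x) • gradient φ x := by
  have h := ((hT.differentiable (by simp) (φ x)).hasDerivAt.comp_hasFDerivAt x
    (hφ.differentiable (by simp) x).hasFDerivAt).fderiv
  rw [gradient, show (fun y => T (φ y)) = T ∘ φ from rfl, h]
  simp [gradient]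

/-- Classical integration by parts against a test function. -/
theorem integral_smul_gradient_eq_neg {ψ φ : Eucl n → ℝ} (hψ : ContDiff ℝ ∞ ψ)
    (hφ : IsTestFunction Ω φ) :
    ∫ x in Ω, ψ x • gradient φ x = - ∫ x in Ω, φ x • gradient ψ x := by
  have hgφ := hasCompactSupport_gradient hφ.compactSupport
  have i1 : Integrable (fun x => ψ x • gradient φ x) :=
    (hψ.continuous.smul (continuous_gradient hφ.smooth)).integrable_of_hasCompactSupport
      hgφ.smul_left
  have i2 : Integrable (fun x => φ x • gradient ψ x) :=
    (hφ.smooth.continuous.smul (continuous_gradient hψ)).integrable_of_hasCompactSupport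
      hφ.compactSupport.smul_right
  -- Both integrands vanish outside `Ω`, so the integrals may be taken over the whole space.
  rw [setIntegral_eq_integral_of_forall_compl_eq_zero, setIntegral_eq_integral_of_forall_compl_eq_zero]
  · refine ext_inner_left ℝ fun e => ?_
    rw [inner_neg_right, ← integral_inner i1, ← integral_inner i2]
    have hd : ∀ {f : Eucl n → ℝ}, ContDiff ℝ ∞ f → ∀ x, inner ℝ e (gradient f x) =
        fderiv ℝ f x e := by
      intro f hf x
      rw [real_inner_comm, (hasGradientAt_of_contDiff hf x).fderiv_apply]
    have h := integral_mul_fderiv_eq_neg_fderiv_mul_of_integrable (μ := (volume : Measure (Eucl n)))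
      (f := ψ) (g := φ) (v := e) ?_ ?_ ?_ (fun x _ => hψ.differentiable (by simp) x)
      (fun x _ => hφ.smooth.differentiable (by simp) x)
    · simpa [inner_smul_right, hd hψ, hd hφ.smooth, mul_comm] using h
    · simpa [inner_smul_right, hd hψ, mul_comm] using i2.const_inner (𝕜 := ℝ) e
    · simpa [inner_smul_right, hd hφ.smooth] using i1.const_inner (𝕜 := ℝ) e
    · exact (hψ.continuous.mul hφ.smooth.continuous).integrable_of_hasCompactSupport
        hφ.compactSupport.mul_left
  · intro x hx
    rw [image_eq_zero_of_notMem_tsupport fun h => hx (hφ.support_subset h), zero_smul]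
  · intro x hx
    rw [gradient_eq_zero_of_notMem_tsupport fun h => hx (hφ.support_subset h), smul_zero]

/-! ### Closedness of the weak gradient -/

theorem tendsto_integral_const_smul {α E : Type*} [MeasurableSpace α]
    [NormedAddCommGroup E] [NormedSpace ℝ E] {μ : Measure α} {f : α → ℝ} {H : ℕ → α → E}
    {h : α → E} (hf : MemLp f 2 μ) (hH : ∀ k, AEStronglyMeasurable (H k) μ)
    (hh : AEStronglyMeasurable h μ) (hi : ∀ k, Integrable (fun x => f x • H k x) μ)
    (hl : Tendsto (fun k => eLpNorm (fun x => H k x - h x) 2 μ) atTop (𝓝 0)) :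
    Tendsto (fun k => ∫ x, f x • H k x ∂μ) atTop (𝓝 (∫ x, f x • h x ∂μ)) := by
  refine tendsto_integral_of_L1' (fun x => f x • h x) (hf.1.smul hh) (Eventually.of_forall hi) ?_
  refine tendsto_of_tendsto_of_tendsto_of_le_of_le tendsto_const_nhds
    (by simpa using ENNReal.Tendsto.const_mul hl (Or.inr hf.eLpNorm_ne_top))
    (fun _ => zero_le) fun k => ?_
  have e : (fun x => f x • H k x) - (fun x => f x • h x) = f • fun x => H k x - h x := by
    ext x
    simp [smul_sub]
  dsimp only
  rw [e]
  exact eLpNorm_smul_le_mul_eLpNorm ((hH k).sub hh) hf.1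

theorem tendsto_integral_smul_const {α E : Type*} [MeasurableSpace α]
    [NormedAddCommGroup E] [NormedSpace ℝ E] {μ : Measure α} {h : α → E} {F : ℕ → α → ℝ}
    {f : α → ℝ} (hh : MemLp h 2 μ) (hF : ∀ k, AEStronglyMeasurable (F k) μ)
    (hf : AEStronglyMeasurable f μ) (hi : ∀ k, Integrable (fun x => F k x • h x) μ)
    (hl : Tendsto (fun k => eLpNorm (fun x => F k x - f x) 2 μ) atTop (𝓝 0)) :
    Tendsto (fun k => ∫ x, F k x • h x ∂μ) atTop (𝓝 (∫ x, f x • h x ∂μ)) := by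
  refine tendsto_integral_of_L1' (fun x => f x • h x) (hf.smul hh.1) (Eventually.of_forall hi) ?_
  refine tendsto_of_tendsto_of_tendsto_of_le_of_le tendsto_const_nhds
    (by simpa using ENNReal.Tendsto.mul_const hl (Or.inr hh.eLpNorm_ne_top))
    (fun _ => zero_le) fun k => ?_
  have e : (fun x => F k x • h x) - (fun x => f x • h x) = (fun x => F k x - f x) • h := by
    ext x
    simp [sub_smul]
  dsimp only
  rw [e]
  exact eLpNorm_smul_le_mul_eLpNorm hh.1 ((hF k).sub hf)

theorem memLp_two_of_compactSupport {E : Type*} [NormedAddCommGroup E] {f : Eucl n → E}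
    (hf : Continuous f) (hc : HasCompactSupport f) : MemLp f 2 (volume.restrict Ω) :=
  (hf.memLp_of_hasCompactSupport hc).restrict _

/-- The weak gradient is closed: if smooth functions converge to `w` and their gradients to `H`
in `L²(Ω)`, then `H` is the weak gradient of `w`. -/
theorem isWeakGradient_of_tendsto {w : L2 Ω} {H : L2Vec Ω} {ψ : ℕ → Eucl n → ℝ}
    (hψ : ∀ k, ContDiff ℝ ∞ (ψ k))
    (hw : Tendsto (fun k => eLpNorm (fun x => ψ k x - w x) 2 (volume.restrict Ω)) atTop (𝓝 0))
    (hH : Tendsto (fun k => eLpNorm (fun x => gradient (ψ k) x - H x) 2 (volume.restrict Ω))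
      atTop (𝓝 0)) : IsWeakGradient w H := by
  intro φ hφ
  have hgφ := hasCompactSupport_gradient hφ.compactSupport
  have cgφ := continuous_gradient hφ.smooth
  have l1 := tendsto_integral_smul_const (memLp_two_of_compactSupport (Ω := Ω) cgφ hgφ)
    (fun k => (hψ k).continuous.aestronglyMeasurable) (Lp.aestronglyMeasurable w)
    (fun k => (((hψ k).continuous.smul cgφ).integrable_of_hasCompactSupport
      hgφ.smul_left).restrict) hw
  have l2 := tendsto_integral_const_smul
    (memLp_two_of_compactSupport (Ω := Ω) hφ.smooth.continuous hφ.compactSupport)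
    (fun k => (continuous_gradient (hψ k)).aestronglyMeasurable) (Lp.aestronglyMeasurable H)
    (fun k => ((hφ.smooth.continuous.smul (continuous_gradient (hψ k))).integrable_of_hasCompactSupport
      hφ.compactSupport.smul_right).restrict) hH
  refine tendsto_nhds_unique l1 ?_
  simpa only [integral_smul_gradient_eq_neg (hψ _) hφ] using l2.neg

/-- A function that is approximated in `H¹(Ω)` by functions smooth on `ℝⁿ` whose boundary values
converge to `g` in `L²(∂Ω)` belongs to `H¹_g(Ω)`. -/
theorem toLp_mem_H1g {w : Eucl n → ℝ} {H : Eucl n → Eucl n} {g : Eucl n → ℝ}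
    (hw : MemLp w 2 (volume.restrict Ω)) (hH : MemLp H 2 (volume.restrict Ω))
    {ψ : ℕ → Eucl n → ℝ} (hψ : ∀ k, ContDiff ℝ ∞ (ψ k))
    (lw : Tendsto (fun k => eLpNorm (fun x => ψ k x - w x) 2 (volume.restrict Ω)) atTop (𝓝 0))
    (lH : Tendsto (fun k => eLpNorm (fun x => gradient (ψ k) x - H x) 2 (volume.restrict Ω))
      atTop (𝓝 0))
    (lg : Tendsto (fun k => eLpNorm (fun x => ψ k x - g x) 2 (surfaceMeasure Ω)) atTop (𝓝 0)) :
    hw.toLp w ∈ H1g Ω g := by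
  have lw' : Tendsto (fun k => eLpNorm (fun x => ψ k x - hw.toLp w x) 2 (volume.restrict Ω))
      atTop (𝓝 0) := by
    refine lw.congr fun k => eLpNorm_congr_ae ?_
    filter_upwards [hw.coeFn_toLp] with x hx
    rw [hx]
  have lH' : Tendsto (fun k => eLpNorm (fun x => gradient (ψ k) x - hH.toLp H x) 2
      (volume.restrict Ω)) atTop (𝓝 0) := by
    refine lH.congr fun k => eLpNorm_congr_ae ?_
    filter_upwards [hH.coeFn_toLp] with x hx
    rw [hx]
  have hwk := isWeakGradient_of_tendsto hψ lw' lH'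
  exact ⟨⟨_, hwk⟩, _, hwk, ψ, hψ, lw', lH', lg⟩

/-! ### Operations on functions with prescribed trace -/

theorem ae_surfaceMeasure_of_forall {P : Eucl n → Prop} (h : ∀ x ∈ frontier Ω, P x) :
    ∀ᵐ x ∂surfaceMeasure Ω, P x :=
  (ae_restrict_iff' isClosed_frontier.measurableSet).2 (Eventually.of_forall h)

theorem aestronglyMeasurable_surfaceMeasure {g : Eucl n → ℝ} (hg : ContinuousOn g (frontier Ω)) :
    AEStronglyMeasurable g (surfaceMeasure Ω) :=
  hg.aestronglyMeasurable isClosed_frontier.measurableSet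

/-- A sequence bounded in norm by a combination of two functions tending to zero in `L²` tends to
zero in `L²`. -/
theorem tendsto_eLpNorm_of_le_add {α E E' E'' : Type*} [MeasurableSpace α]
    [NormedAddCommGroup E] [NormedAddCommGroup E'] [NormedAddCommGroup E''] {μ : Measure α}
    {f : ℕ → α → E} {a : ℕ → α → E'} {b : ℕ → α → E''} (C : ℝ)
    (ha : ∀ k, AEStronglyMeasurable (a k) μ) (hb : ∀ k, AEStronglyMeasurable (b k) μ)
    (la : Tendsto (fun k => eLpNorm (a k) 2 μ) atTop (𝓝 0))
    (lb : Tendsto (fun k => eLpNorm (b k) 2 μ) atTop (𝓝 0))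
    (h : ∀ k, ∀ᵐ x ∂μ, ‖f k x‖ ≤ C * (‖a k x‖ + ‖b k x‖)) :
    Tendsto (fun k => eLpNorm (f k) 2 μ) atTop (𝓝 0) := by
  have hlim : Tendsto (fun k => ENNReal.ofReal C * (eLpNorm (a k) 2 μ + eLpNorm (b k) 2 μ))
      atTop (𝓝 0) := by
    simpa using ENNReal.Tendsto.const_mul (la.add lb) (Or.inr ENNReal.ofReal_ne_top)
  refine tendsto_of_tendsto_of_tendsto_of_le_of_le tendsto_const_nhds hlim (fun _ => zero_le)
    fun k => ?_
  have h1 : eLpNorm (f k) 2 μ ≤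
      ENNReal.ofReal C * eLpNorm (fun x => ‖a k x‖ + ‖b k x‖) 2 μ := by
    refine eLpNorm_le_mul_eLpNorm_of_ae_le_mul ?_ 2
    filter_upwards [h k] with x hx
    rwa [Real.norm_of_nonneg (by positivity : 0 ≤ ‖a k x‖ + ‖b k x‖)]
  refine h1.trans (mul_le_mul_right ?_ _)
  refine (eLpNorm_add_le (ha k).norm (hb k).norm (by norm_num)).trans ?_
  rw [eLpNorm_norm, eLpNorm_norm]

theorem tendsto_eLpNorm_of_le {α E E' : Type*} [MeasurableSpace α]
    [NormedAddCommGroup E] [NormedAddCommGroup E'] {μ : Measure α}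
    {f : ℕ → α → E} {a : ℕ → α → E'} (C : ℝ) (la : Tendsto (fun k => eLpNorm (a k) 2 μ) atTop (𝓝 0))
    (h : ∀ k, ∀ᵐ x ∂μ, ‖f k x‖ ≤ C * ‖a k x‖) :
    Tendsto (fun k => eLpNorm (f k) 2 μ) atTop (𝓝 0) :=
  tendsto_of_tendsto_of_tendsto_of_le_of_le tendsto_const_nhds
    (by simpa using ENNReal.Tendsto.const_mul la (Or.inr (ENNReal.ofReal_ne_top (r := C))))
    (fun _ => zero_le) fun k => eLpNorm_le_mul_eLpNorm_of_ae_le_mul (h k) 2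

theorem add_mem_H1g {u v : L2 Ω} {g h : Eucl n → ℝ} (hg : ContinuousOn g (frontier Ω))
    (hh : ContinuousOn h (frontier Ω)) (hu : u ∈ H1g Ω g) (hv : v ∈ H1g Ω h) :
    u + v ∈ H1g Ω (fun x => g x + h x) := by
  obtain ⟨-, G, -, φ, hφ, l1, l2, l3⟩ := hu
  obtain ⟨-, H, -, ψ, hψ, m1, m2, m3⟩ := hv
  have mu := Lp.memLp u
  have mv := Lp.memLp v
  have mG := Lp.memLp G
  have mH := Lp.memLp H
  rw [← Lp.toLp_coeFn u mu, ← Lp.toLp_coeFn v mv, ← MemLp.toLp_add]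
  refine toLp_mem_H1g (mu.add mv) (mG.add mH) (fun k => (hφ k).add (hψ k)) ?_ ?_ ?_
  · refine tendsto_eLpNorm_of_le_add 1 (fun k => (hφ k).continuous.aestronglyMeasurable.sub mu.1)
      (fun k => (hψ k).continuous.aestronglyMeasurable.sub mv.1) l1 m1
      fun k => Eventually.of_forall fun x => ?_
    rw [one_mul]
    exact (congrArg norm (add_sub_add_comm _ _ _ _)).trans_le (norm_add_le _ _)
  · refine tendsto_eLpNorm_of_le_add 1
      (fun k => (continuous_gradient (hφ k)).aestronglyMeasurable.sub mG.1)
      (fun k => (continuous_gradient (hψ k)).aestronglyMeasurable.sub mH.1) l2 m2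
      fun k => Eventually.of_forall fun x => ?_
    rw [one_mul, gradient_add (hφ k) (hψ k)]
    exact (congrArg norm (add_sub_add_comm _ _ _ _)).trans_le (norm_add_le _ _)
  · refine tendsto_eLpNorm_of_le_add 1
      (fun k => (hφ k).continuous.aestronglyMeasurable.sub (aestronglyMeasurable_surfaceMeasure hg))
      (fun k => (hψ k).continuous.aestronglyMeasurable.sub (aestronglyMeasurable_surfaceMeasure hh))
      l3 m3 fun k => Eventually.of_forall fun x => ?_
    rw [one_mul]
    exact (congrArg norm (add_sub_add_comm _ _ _ _)).trans_le (norm_add_le _ _)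

theorem smul_mem_H1g {u : L2 Ω} {g : Eucl n → ℝ} (c : ℝ) (hu : u ∈ H1g Ω g) :
    c • u ∈ H1g Ω (fun x => c * g x) := by
  obtain ⟨-, G, -, φ, hφ, l1, l2, l3⟩ := hu
  have mu := Lp.memLp u
  have mG := Lp.memLp G
  rw [← Lp.toLp_coeFn u mu, ← MemLp.toLp_const_smul]
  refine toLp_mem_H1g (mu.const_smul c) (mG.const_smul c) (ψ := fun k x => c * φ k x)
    (fun k => contDiff_const.mul (hφ k)) ?_ ?_ ?_
  · refine tendsto_eLpNorm_of_le |c| l1 fun k => Eventually.of_forall fun x => ?_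
    rw [Pi.smul_apply, smul_eq_mul, ← mul_sub, norm_mul, Real.norm_eq_abs c]
  · refine tendsto_eLpNorm_of_le |c| l2 fun k => Eventually.of_forall fun x => ?_
    rw [Pi.smul_apply, gradient_const_mul (hφ k), ← smul_sub, norm_smul, Real.norm_eq_abs]
  · refine tendsto_eLpNorm_of_le |c| l3 fun k => Eventually.of_forall fun x => ?_
    rw [← mul_sub, norm_mul, Real.norm_eq_abs c]

/-- A smooth function with compact support belongs to `H¹(Ω)`, its trace being its restriction. -/
theorem toLp_mem_H1g_of_contDiff {φ : Eucl n → ℝ} (hφ : ContDiff ℝ ∞ φ)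
    (hc : HasCompactSupport φ) :
    (memLp_two_of_compactSupport (Ω := Ω) hφ.continuous hc).toLp φ ∈ H1g Ω φ :=
  toLp_mem_H1g _ (memLp_two_of_compactSupport (continuous_gradient hφ)
    (hasCompactSupport_gradient hc)) (fun _ => hφ) (by simp) (by simp) (by simp)

theorem H1g_congr {g h : Eucl n → ℝ} (hgh : ∀ x ∈ frontier Ω, g x = h x) :
    H1g Ω g ⊆ H1g Ω h := by
  rintro u ⟨hu, G, hG, φ, hφ, l1, l2, l3⟩
  refine ⟨hu, G, hG, φ, hφ, l1, l2, l3.congr fun k => eLpNorm_congr_ae ?_⟩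
  filter_upwards [ae_surfaceMeasure_of_forall hgh] with x hx
  rw [hx]

/-- Multiplication by a smooth compactly supported `χ` maps `H¹_g(Ω)` to `H¹_{χg}(Ω)`. -/
theorem exists_mem_H1g_eq_mul {u : L2 Ω} {g χ : Eucl n → ℝ} (hχ : ContDiff ℝ ∞ χ)
    (hc : HasCompactSupport χ) (hu : u ∈ H1g Ω g) :
    ∃ w ∈ H1g Ω (fun x => χ x * g x), w =ᵐ[volume.restrict Ω] fun x => χ x * u x := by
  obtain ⟨-, G, -, φ, hφ, l1, l2, l3⟩ := hu
  obtain ⟨A, hA⟩ := hχ.continuous.bounded_above_of_compact_support hc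
  obtain ⟨B, hB⟩ := (continuous_gradient hχ).bounded_above_of_compact_support
    (hasCompactSupport_gradient hc)
  have mu := Lp.memLp u
  have mG := Lp.memLp G
  have mw : MemLp (fun x => χ x * u x) 2 (volume.restrict Ω) :=
    mu.of_le_mul (hχ.continuous.aestronglyMeasurable.mul mu.1) (c := A)
      (Eventually.of_forall fun x => by
        rw [norm_mul]; exact mul_le_mul_of_nonneg_right (hA x) (norm_nonneg _))
  have mH1 : MemLp (fun x => χ x • G x) 2 (volume.restrict Ω) :=
    mG.of_le_mul (hχ.continuous.aestronglyMeasurable.smul mG.1) (c := A)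
      (Eventually.of_forall fun x => by
        rw [norm_smul]; exact mul_le_mul_of_nonneg_right (hA x) (norm_nonneg _))
  have mH2 : MemLp (fun x => u x • gradient χ x) 2 (volume.restrict Ω) :=
    mu.of_le_mul (mu.1.smul (continuous_gradient hχ).aestronglyMeasurable) (c := B)
      (Eventually.of_forall fun x => by
        rw [norm_smul, mul_comm]; exact mul_le_mul_of_nonneg_right (hB x) (norm_nonneg _))
  refine ⟨mw.toLp _, toLp_mem_H1g mw (mH1.add mH2) (ψ := fun k x => χ x * φ k x)
    (fun k => hχ.mul (hφ k)) ?_ ?_ ?_, mw.coeFn_toLp⟩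
  · refine tendsto_eLpNorm_of_le A l1 fun k => Eventually.of_forall fun x => ?_
    rw [← mul_sub, norm_mul]
    exact mul_le_mul_of_nonneg_right (hA x) (norm_nonneg _)
  · refine tendsto_eLpNorm_of_le_add (max A B)
      (fun k => (continuous_gradient (hφ k)).aestronglyMeasurable.sub mG.1)
      (fun k => (hφ k).continuous.aestronglyMeasurable.sub mu.1) l2 l1
      fun k => Eventually.of_forall fun x => ?_
    rw [Pi.add_apply, gradient_mul hχ (hφ k), add_sub_add_comm, ← smul_sub, ← sub_smul, mul_add]
    refine (norm_add_le _ _).trans (add_le_add ?_ ?_)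
    · rw [norm_smul]
      exact mul_le_mul_of_nonneg_right ((hA x).trans (le_max_left _ _)) (norm_nonneg _)
    · rw [norm_smul, mul_comm]
      exact mul_le_mul_of_nonneg_right ((hB x).trans (le_max_right _ _)) (norm_nonneg _)
  · refine tendsto_eLpNorm_of_le A l3 fun k => Eventually.of_forall fun x => ?_
    rw [← mul_sub, norm_mul]
    exact mul_le_mul_of_nonneg_right (hA x) (norm_nonneg _)

/-! ### Truncation -/

theorem exists_smooth_truncation (M : ℝ) :
    ∃ T : ℝ → ℝ, ∃ C : ℝ, ContDiff ℝ ∞ T ∧ (∀ s, |s| ≤ M → T s = s) ∧ (∀ s, |T s| ≤ C) ∧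
      ∀ s, |deriv T s| ≤ C := by
  let β : ContDiffBump (0 : ℝ) := ⟨|M| + 1, |M| + 2, by positivity, by linarith⟩
  have hT : ContDiff ℝ ∞ fun s => s * β s := contDiff_id.mul β.contDiff
  have hc : HasCompactSupport fun s => s * β s := β.hasCompactSupport.mul_left
  obtain ⟨A, hA⟩ := hT.continuous.bounded_above_of_compact_support hc
  obtain ⟨B, hB⟩ := (hT.continuous_deriv (by simp)).bounded_above_of_compact_support hc.deriv
  refine ⟨_, max A B, hT, fun s hs => ?_,
    fun s => (hA s).trans (le_max_left _ _), fun s => (hB s).trans (le_max_right _ _)⟩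
  rw [β.one_of_mem_closedBall, mul_one]
  rw [mem_closedBall_zero_iff, Real.norm_eq_abs]
  exact hs.trans ((le_abs_self M).trans (by linarith [show β.rIn = |M| + 1 from rfl]))

theorem tendsto_eLpNorm_smul_of_ae_tendsto {α E : Type*} [MeasurableSpace α]
    [NormedAddCommGroup E] [NormedSpace ℝ E] {μ : Measure α} {a : ℕ → α → ℝ} {G : α → E}
    (hG : MemLp G 2 μ) (ha : ∀ k, AEStronglyMeasurable (a k) μ) {C : ℝ}
    (hC : ∀ k x, |a k x| ≤ C) (h : ∀ᵐ x ∂μ, Tendsto (fun k => a k x) atTop (𝓝 0)) :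
    Tendsto (fun k => eLpNorm (fun x => a k x • G x) 2 μ) atTop (𝓝 0) := by
  have hl : Tendsto (fun k => ∫⁻ x, ‖a k x • G x‖ₑ ^ (2 : ℝ) ∂μ) atTop (𝓝 (∫⁻ _, 0 ∂μ)) := by
    refine tendsto_lintegral_of_dominated_convergence' (fun x => ‖C • G x‖ₑ ^ (2 : ℝ))
      (fun k => ((ha k).smul hG.1).enorm.pow_const _) (fun k => Eventually.of_forall fun x => ?_)
      ?_ ?_
    · refine ENNReal.rpow_le_rpow (enorm_le_iff_norm_le.2 ?_) (by norm_num)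
      rw [norm_smul, norm_smul, Real.norm_eq_abs, Real.norm_eq_abs]
      exact mul_le_mul_of_nonneg_right ((hC k x).trans (le_abs_self C)) (norm_nonneg _)
    · exact (lintegral_rpow_enorm_lt_top_of_eLpNorm_lt_top (p := 2) (by norm_num) (by norm_num)
        (hG.const_smul C).2).ne
    · filter_upwards [h] with x hx
      have h1 : Tendsto (fun k => a k x • G x) atTop (𝓝 0) := by
        simpa using hx.smul_const (G x)
      have h2 := (ENNReal.continuous_rpow_const (y := (2 : ℝ))).tendsto _ |>.comp h1.enorm
      simpa [Function.comp_def] using h2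
  rw [lintegral_zero] at hl
  have h2 := (ENNReal.continuous_rpow_const (y := 1 / (2 : ℝ))).tendsto _ |>.comp hl
  have e : ∀ k, eLpNorm (fun x => a k x • G x) 2 μ
      = (∫⁻ x, ‖a k x • G x‖ₑ ^ (2 : ℝ) ∂μ) ^ (1 / (2 : ℝ)) := fun k => by
    rw [eLpNorm_eq_lintegral_rpow_enorm_toReal (by norm_num) (by norm_num)]
    simp
  simp_rw [e]
  simpa [Function.comp_def] using h2

/-- A boundary datum `g` with `|g| ≤ M` that is the trace of some function in `H¹(Ω)` is the trace
of a bounded one. -/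
theorem exists_bounded_mem_H1g {u : L2 Ω} {g : Eucl n → ℝ} (hΩ : volume Ω ≠ ⊤) {M : ℝ}
    (hg : ∀ x ∈ frontier Ω, |g x| ≤ M) (hu : u ∈ H1g Ω g) :
    ∃ w ∈ H1g Ω g, ∃ C : ℝ, ∀ᵐ x ∂volume.restrict Ω, |w x| ≤ C := by
  have : IsFiniteMeasure (volume.restrict Ω) := ⟨by simpa using hΩ.lt_top⟩
  obtain ⟨T, C, hT, hTM, hTC, hTC'⟩ := exists_smooth_truncation M
  have hlip : ∀ s t, |T s - T t| ≤ C * |s - t| := fun s t =>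
    Convex.norm_image_sub_le_of_norm_deriv_le (fun x _ => hT.differentiable (by simp) x)
      (fun x _ => hTC' x) convex_univ (Set.mem_univ t) (Set.mem_univ s)
  have cT' : Continuous (deriv T) := hT.continuous_deriv (by simp)
  obtain ⟨-, G, -, φ₀, hφ₀, l1, l2, l3⟩ := hu
  have mu := Lp.memLp u
  have mG := Lp.memLp G
  obtain ⟨ns, hns, hae⟩ := (tendstoInMeasure_of_tendsto_eLpNorm (p := 2) (by norm_num)
    (fun k => (hφ₀ k).continuous.aestronglyMeasurable) mu.1 l1).exists_seq_tendsto_ae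
  -- Along a subsequence the approximations also converge almost everywhere, which gives
  -- `(T' (φ k) - T' u) • G → 0` in `L²` by dominated convergence.
  obtain ⟨φ, hφe⟩ : ∃ φ : ℕ → Eucl n → ℝ, φ = fun k => φ₀ (ns k) := ⟨_, rfl⟩
  have hφ : ∀ k, ContDiff ℝ ∞ (φ k) := fun k => hφe ▸ hφ₀ (ns k)
  replace hae : ∀ᵐ x ∂volume.restrict Ω, Tendsto (fun k => φ k x) atTop (𝓝 (u x)) := hφe ▸ hae
  replace l1 : Tendsto (fun k => eLpNorm (fun x => φ k x - u x) 2 (volume.restrict Ω))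
    atTop (𝓝 0) := hφe ▸ l1.comp hns.tendsto_atTop
  replace l2 : Tendsto (fun k => eLpNorm (fun x => gradient (φ k) x - G x) 2
    (volume.restrict Ω)) atTop (𝓝 0) := hφe ▸ l2.comp hns.tendsto_atTop
  replace l3 : Tendsto (fun k => eLpNorm (fun x => φ k x - g x) 2 (surfaceMeasure Ω))
    atTop (𝓝 0) := hφe ▸ l3.comp hns.tendsto_atTop
  have mT'u : AEStronglyMeasurable (fun x => deriv T (u x)) (volume.restrict Ω) :=
    cT'.comp_aestronglyMeasurable mu.1
  have mw : MemLp (fun x => T (u x)) 2 (volume.restrict Ω) :=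
    MemLp.of_bound (hT.continuous.comp_aestronglyMeasurable mu.1) C
      (Eventually.of_forall fun x => hTC _)
  have mH : MemLp (fun x => deriv T (u x) • G x) 2 (volume.restrict Ω) :=
    mG.of_le_mul (mT'u.smul mG.1) (c := C) (Eventually.of_forall fun x => by
      rw [norm_smul]; exact mul_le_mul_of_nonneg_right (hTC' _) (norm_nonneg _))
  have mT'φ : ∀ k, AEStronglyMeasurable (fun x => deriv T (φ k x)) (volume.restrict Ω) :=
    fun k => (cT'.comp (hφ k).continuous).aestronglyMeasurable
  have ldom : Tendsto (fun k => eLpNorm (fun x => (deriv T (φ k x) - deriv T (u x)) • G x) 2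
      (volume.restrict Ω)) atTop (𝓝 0) := by
    refine tendsto_eLpNorm_smul_of_ae_tendsto mG (fun k => (mT'φ k).sub mT'u) (C := C + C)
      (fun k x => (abs_sub _ _).trans (add_le_add (hTC' _) (hTC' _))) ?_
    filter_upwards [hae] with x hx
    simpa using ((cT'.tendsto _).comp hx).sub_const (deriv T (u x))
  refine ⟨mw.toLp _, toLp_mem_H1g mw mH (ψ := fun k x => T (φ k x)) (fun k => hT.comp (hφ k))
    ?_ ?_ ?_, C, ?_⟩
  · exact tendsto_eLpNorm_of_le C l1 fun k => Eventually.of_forall fun x => hlip _ _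
  · refine tendsto_eLpNorm_of_le_add (max C 1)
      (fun k => (continuous_gradient (hφ k)).aestronglyMeasurable.sub mG.1)
      (fun k => ((mT'φ k).sub mT'u).smul mG.1) l2 ldom
      fun k => Eventually.of_forall fun x => ?_
    have e : gradient (fun y => T (φ k y)) x - deriv T (u x) • G x
        = deriv T (φ k x) • (gradient (φ k) x - G x)
          + (deriv T (φ k x) - deriv T (u x)) • G x := by
      rw [gradient_comp hT (hφ k), smul_sub, sub_smul]
      abel
    rw [e, mul_add]
    refine (norm_add_le _ _).trans (add_le_add ?_ ?_)
    · rw [norm_smul]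
      exact mul_le_mul_of_nonneg_right ((hTC' _).trans (le_max_left _ _)) (norm_nonneg _)
    · exact le_mul_of_one_le_left (norm_nonneg _) (le_max_right _ _)
  · refine tendsto_eLpNorm_of_le C l3 fun k => ae_surfaceMeasure_of_forall fun x hx => ?_
    have := hlip (φ k x) (g x)
    rwa [hTM _ (hg x hx)] at this
  · filter_upwards [mw.coeFn_toLp] with x hx
    rw [hx]
    exact hTC _

/-! ### Extensions of small critical norm -/

/-- The critical Sobolev exponent `2n/(n-2)`. -/
noncomputable abbrev critExp (n : ℕ) : ℝ≥0∞ := ENNReal.ofReal (2 * (n : ℝ) / ((n : ℝ) - 2))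

theorem one_le_critExp (hn : 3 ≤ n) : 1 ≤ critExp n := by
  have h : (3 : ℝ) ≤ n := by exact_mod_cast hn
  rw [critExp, ENNReal.one_le_ofReal, le_div_iff₀ (by linarith)]
  linarith

theorem exists_smooth_cutoff {K F : Set (Eucl n)} (hK : IsClosed K) (hF : IsCompact F)
    (hd : Disjoint K F) :
    ∃ χ : Eucl n → ℝ, ContDiff ℝ ∞ χ ∧ HasCompactSupport χ ∧ (∀ x ∈ K, χ x = 0) ∧
      (∀ x ∈ F, χ x = 1) ∧ ∀ x, |χ x| ≤ 1 := by
  obtain ⟨R, hR⟩ := hF.isBounded.subset_ball 0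
  obtain ⟨f, h0, h1, hf⟩ := exists_contMDiffMap_zero_one_of_isClosed
    (modelWithCornersSelf ℝ (Eucl n)) (n := ⊤) (s := K ∪ (Metric.ball 0 R)ᶜ) (t := F)
    (hK.union Metric.isOpen_ball.isClosed_compl) hF.isClosed
    (Set.disjoint_union_left.2 ⟨hd, Set.disjoint_compl_left_iff_subset.2 hR⟩)
  refine ⟨f, f.contMDiff.contDiff, ?_, fun x hx => h0 (Or.inl hx), fun x hx => h1 hx,
    fun x => abs_le.2 ⟨by linarith [(hf x).1], (hf x).2⟩⟩
  refine HasCompactSupport.intro (isCompact_closedBall (0 : Eucl n) R) fun x hx => ?_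
  exact h0 (Or.inr fun h => hx (Metric.ball_subset_closedBall h))

/-- Every bounded boundary datum that is a trace is the trace of some function whose critical norm
is less than one: multiply a bounded extension by a cutoff function equal to one on `∂Ω` and
vanishing on a compact subset of `Ω` of nearly full measure. -/
theorem exists_mem_H1g_critNorm_lt_one (hn : 3 ≤ n) (hΩo : IsOpen Ω)
    (hΩb : Bornology.IsBounded Ω) {u : L2 Ω} {g : Eucl n → ℝ} {M : ℝ}
    (hg : ∀ x ∈ frontier Ω, |g x| ≤ M) (hu : u ∈ H1g Ω g) :
    ∃ w ∈ H1g Ω g, critNorm w < 1 := by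
  have hv : volume Ω ≠ ⊤ := hΩb.measure_lt_top.ne
  have hq1 := one_le_critExp hn
  have hq0 : critExp n ≠ 0 := (zero_lt_one.trans_le hq1).ne'
  have hqt : critExp n ≠ ⊤ := ENNReal.ofReal_ne_top
  have hqr : 0 < (critExp n).toReal := ENNReal.toReal_pos hq0 hqt
  obtain ⟨w, hw, C, hC⟩ := exists_bounded_mem_H1g hv hg hu
  have hD : 0 < |C| + 1 := by positivity
  have hε : ENNReal.ofReal (1 / (|C| + 1)) ^ (critExp n).toReal ≠ 0 :=
    (ENNReal.rpow_pos (ENNReal.ofReal_pos.2 (by positivity)) ENNReal.ofReal_ne_top).ne'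
  obtain ⟨K, hKΩ, hK, hKε⟩ := hΩo.measurableSet.exists_isCompact_sdiff_lt hv hε
  have hdis : Disjoint Ω (frontier Ω) := (Set.disjoint_iff_inter_eq_empty.2 hΩo.inter_frontier_eq)
  obtain ⟨χ, hχ, hχc, hχK, hχF, hχ1⟩ := exists_smooth_cutoff hK.isClosed
    (hΩb.isCompact_closure.of_isClosed_subset isClosed_frontier frontier_subset_closure)
    (hdis.mono_left hKΩ)
  obtain ⟨z, hz, hzw⟩ := exists_mem_H1g_eq_mul hχ hχc hw
  refine ⟨z, H1g_congr (fun x hx => by rw [hχF x hx, one_mul]) hz, ?_⟩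
  have hle : critNorm z ≤ eLpNorm (Kᶜ.indicator fun _ => C) (critExp n) (volume.restrict Ω) := by
    refine eLpNorm_mono_ae ?_
    filter_upwards [hzw, hC] with x hx hCx
    rw [hx, norm_mul]
    by_cases hxK : x ∈ K
    · simp [hχK x hxK]
    · rw [Set.indicator_of_mem (Set.mem_compl hxK), Real.norm_eq_abs C]
      exact (mul_le_of_le_one_left (norm_nonneg _) (hχ1 x)).trans (hCx.trans (le_abs_self C))
  refine hle.trans_lt ?_
  rw [eLpNorm_indicator_const hK.measurableSet.compl hq0 hqt,
    Measure.restrict_apply hK.measurableSet.compl, Set.inter_comm, ← Set.sdiff_eq]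
  have h1 : volume (Ω \ K) ^ (1 / (critExp n).toReal) ≤ ENNReal.ofReal (1 / (|C| + 1)) := by
    rw [one_div, ENNReal.rpow_inv_le_iff hqr]
    exact hKε.le
  calc ‖C‖ₑ * volume (Ω \ K) ^ (1 / (critExp n).toReal)
      ≤ ENNReal.ofReal |C| * ENNReal.ofReal (1 / (|C| + 1)) := by
        rw [Real.enorm_eq_ofReal_abs]
        exact mul_le_mul_right h1 _
    _ = ENNReal.ofReal (|C| / (|C| + 1)) := by
        rw [← ENNReal.ofReal_mul (abs_nonneg C), mul_one_div]
    _ < 1 := by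
        rw [ENNReal.ofReal_lt_one, div_lt_one hD]
        linarith

/-! ### Rays and the unit sphere -/

theorem critNorm_smul (c : ℝ) (u : L2 Ω) : critNorm (c • u) = ENNReal.ofReal |c| * critNorm u := by
  rw [critNorm, eLpNorm_congr_ae (Lp.coeFn_smul c u), eLpNorm_const_smul, Real.enorm_eq_ofReal_abs]
  rfl

theorem critNorm_add_le (hn : 3 ≤ n) (u v : L2 Ω) :
    critNorm (u + v) ≤ critNorm u + critNorm v := by
  rw [critNorm, eLpNorm_congr_ae (Lp.coeFn_add u v)]
  exact eLpNorm_add_le (Lp.aestronglyMeasurable u) (Lp.aestronglyMeasurable v) (one_le_critExp hn)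

/-- A ray issuing from a point of the open unit ball of a normed space meets the unit sphere exactly
once. -/
theorem exists_unique_norm_smul_add_eq_one {E : Type*} [NormedAddCommGroup E] [NormedSpace ℝ E]
    {U W : E} (hU : U ≠ 0) (hW : ‖W‖ < 1) :
    ∃ t : ℝ, 0 < t ∧ ‖t • U + W‖ = 1 ∧ ∀ s : ℝ, 0 < s → ‖s • U + W‖ = 1 → s = t := by
  have hUp : 0 < ‖U‖ := norm_pos_iff.2 hU
  -- By convexity the norm stays below one before its first passage through the value one.
  have key : ∀ s t : ℝ, 0 < s → s < t → ‖s • U + W‖ = 1 → ‖t • U + W‖ = 1 → False := by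
    intro s t hs hst h1 h2
    have ht : 0 < t := hs.trans hst
    have hr : s / t < 1 := (div_lt_one ht).2 hst
    have e : s • U + W = (s / t) • (t • U + W) + (1 - s / t) • W := by
      rw [smul_add, smul_smul, div_mul_cancel₀ _ ht.ne', sub_smul, one_smul]
      abel
    have h3 : ‖s • U + W‖ ≤ s / t * 1 + (1 - s / t) * ‖W‖ := by
      rw [e]
      refine (norm_add_le _ _).trans_eq ?_
      rw [norm_smul, norm_smul, h2, Real.norm_of_nonneg (by positivity : 0 ≤ s / t),
        Real.norm_of_nonneg (by linarith : 0 ≤ 1 - s / t)]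
    nlinarith [mul_lt_mul_of_pos_left hW (by linarith : 0 < 1 - s / t)]
  have hcont : Continuous fun t : ℝ => ‖t • U + W‖ := by fun_prop
  have hT : 0 ≤ 2 / ‖U‖ := by positivity
  have hbig : 1 ≤ ‖(2 / ‖U‖) • U + W‖ := by
    have h := norm_sub_norm_le ((2 / ‖U‖) • U) (-W)
    rw [sub_neg_eq_add, norm_neg, norm_smul, Real.norm_of_nonneg hT, div_mul_cancel₀ _ hUp.ne'] at h
    linarith
  obtain ⟨t, ht, ht1⟩ := intermediate_value_Icc hT hcont.continuousOn
    (show (1 : ℝ) ∈ Set.Icc _ _ from ⟨by simpa using hW.le, hbig⟩)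
  have ht0 : 0 < t := by
    refine ht.1.lt_of_ne fun h => hW.ne ?_
    simpa [← h] using ht1
  refine ⟨t, ht0, ht1, fun s hs hs1 => ?_⟩
  rcases lt_trichotomy s t with h | h | h
  · exact (key s t hs h hs1 ht1).elim
  · exact h
  · exact (key t s ht0 h ht1 hs1).elim

theorem exists_unique_critNorm_smul_add_eq_one (hn : 3 ≤ n) {u w : L2 Ω} (hu0 : critNorm u ≠ 0)
    (hut : critNorm u ≠ ⊤) (hw : critNorm w < 1) :
    ∃ t : ℝ, 0 < t ∧ critNorm (t • u + w) = 1 ∧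
      ∀ s : ℝ, 0 < s → critNorm (s • u + w) = 1 → s = t := by
  have : Fact (1 ≤ critExp n) := ⟨one_le_critExp hn⟩
  have mu : MemLp u (critExp n) (volume.restrict Ω) := ⟨Lp.aestronglyMeasurable u, hut.lt_top⟩
  have mw : MemLp w (critExp n) (volume.restrict Ω) :=
    ⟨Lp.aestronglyMeasurable w, hw.trans ENNReal.one_lt_top⟩
  have hnorm : ∀ t : ℝ, critNorm (t • u + w) = 1 ↔ ‖t • mu.toLp u + mw.toLp w‖ = 1 := by
    intro t
    have e : critNorm (t • u + w) = eLpNorm (t • ⇑u + ⇑w) (critExp n)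
        (volume.restrict Ω) := by
      refine eLpNorm_congr_ae ((Lp.coeFn_add _ _).trans ?_)
      filter_upwards [Lp.coeFn_smul t u] with x hx
      rw [Pi.add_apply, Pi.add_apply, hx]
    rw [← MemLp.toLp_const_smul, ← MemLp.toLp_add, Lp.norm_toLp, e, ENNReal.toReal_eq_one_iff]
  simp_rw [hnorm]
  refine exists_unique_norm_smul_add_eq_one (fun h => hu0 ?_) ?_
  · have := congrArg norm h
    rw [Lp.norm_toLp, norm_zero, ENNReal.toReal_eq_zero_iff] at this
    exact this.resolve_right hut
  · rw [Lp.norm_toLp]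
    exact ENNReal.toReal_lt_of_lt_ofReal (by rw [ENNReal.ofReal_one]; exact hw)

/-- Every `w ∈ H¹_g(Ω)` of critical norm less than one can be moved into `Σ_g`. -/
theorem sigmaSet_nonempty (hn : 3 ≤ n) (hΩo : IsOpen Ω) (hΩn : Ω.Nonempty) {g : Eucl n → ℝ}
    (hg : ContinuousOn g (frontier Ω)) {w : L2 Ω} (hw : w ∈ H1g Ω g) (hw1 : critNorm w < 1) :
    (SigmaSet Ω g).Nonempty := by
  obtain ⟨x, hx⟩ := hΩn
  obtain ⟨φ, hφs, hφc, hφ, -, hφx⟩ := exists_contDiff_tsupport_subset (n := ⊤) (hΩo.mem_nhds hx)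
  have mφ := memLp_two_of_compactSupport (Ω := Ω) hφ.continuous hφc
  have e : critNorm (mφ.toLp φ) = eLpNorm φ (critExp n) (volume.restrict Ω) :=
    eLpNorm_congr_ae mφ.coeFn_toLp
  have h0 : critNorm (mφ.toLp φ) ≠ 0 := by
    rw [e, Ne, eLpNorm_eq_zero_iff hφ.continuous.aestronglyMeasurable
      (zero_lt_one.trans_le (one_le_critExp hn)).ne']
    intro h
    have hop : IsOpen {y | φ y ≠ 0} := isOpen_ne_fun hφ.continuous continuous_const
    refine (hop.measure_pos volume ⟨x, by simp [hφx]⟩).ne' ?_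
    have h' : volume.restrict Ω {y | φ y ≠ 0} = 0 := h
    have hsub : {y | φ y ≠ 0} ⊆ Ω := fun y hy => hφs (subset_tsupport φ hy)
    rwa [Measure.restrict_apply hop.measurableSet, Set.inter_eq_left.2 hsub] at h'
  have ht : critNorm (mφ.toLp φ) ≠ ⊤ := by
    rw [e]
    exact ((hφ.continuous.memLp_of_hasCompactSupport hφc).restrict Ω).eLpNorm_ne_top
  obtain ⟨t, -, ht1, -⟩ := exists_unique_critNorm_smul_add_eq_one hn h0 ht hw1
  have hφ0 : ∀ y ∈ frontier Ω, φ y = 0 := fun y hy => image_eq_zero_of_notMem_tsupport fun h =>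
    (Set.disjoint_left.1 (Set.disjoint_iff_inter_eq_empty.2 hΩo.inter_frontier_eq)) (hφs h) hy
  refine ⟨_, H1g_congr (fun y hy => ?_) (add_mem_H1g (g := fun y => t * φ y)
    ((continuous_const.mul hφ.continuous).continuousOn) hg
    (smul_mem_H1g t (toLp_mem_H1g_of_contDiff hφ hφc)) hw), ht1⟩
  rw [hφ0 y hy, mul_zero, zero_add]

end CritSob

theorem proposition1p2 (n : ℕ) (hn : 3 ≤ n)
    (Ω : Set (CritSob.Eucl n)) (hΩ : CritSob.IsBoundedC1Domain Ω)
    (p : CritSob.Eucl n → ℝ) (c₁ c₂ : ℝ) (hc₁ : 0 < c₁)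
    (hp_bounds : ∀ x ∈ closure Ω, c₁ ≤ p x ∧ p x ≤ c₂)
    (hp_cont : ContinuousOn p (closure Ω))
    (hp_H1 : ∃ P ∈ CritSob.H1 Ω, P =ᵐ[volume.restrict Ω] p)
    (g : CritSob.Eucl n → ℝ) (hg_half : CritSob.MemHHalf Ω g)
    (hg_cont : ContinuousOn g (frontier Ω))
    (v : CritSob.L2 Ω) (hv : CritSob.IsDirichletSolution Ω p g v) :
    (CritSob.critNorm v < 1 →
      ∃ t : CritSob.L2 Ω → ℝ,
        (∀ u ∈ CritSob.SigmaSet Ω (fun _ => 0),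
          0 < t u ∧ CritSob.critNorm (t u • u + v) = 1 ∧
            ∀ s : ℝ, 0 < s → CritSob.critNorm (s • u + v) = 1 → s = t u) ∧
        Set.BijOn (fun u => t u • u + v)
          (CritSob.SigmaSet Ω (fun _ => 0)) (CritSob.SigmaSet Ω g)) ∧
    (1 ≤ CritSob.critNorm v → (CritSob.SigmaSet Ω g).Nonempty) := by
  have hF : IsCompact (frontier Ω) :=
    hΩ.isBounded.isCompact_closure.of_isClosed_subset isClosed_frontier frontier_subset_closure
  refine ⟨fun hv1 => ?_, fun _ => ?_⟩
  · have hex : ∀ u ∈ CritSob.SigmaSet Ω (fun _ => 0), ∃ t : ℝ, 0 < t ∧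
        CritSob.critNorm (t • u + v) = 1 ∧
        ∀ s : ℝ, 0 < s → CritSob.critNorm (s • u + v) = 1 → s = t := fun u hu =>
      CritSob.exists_unique_critNorm_smul_add_eq_one hn (by simp [hu.2]) (by simp [hu.2]) hv1
    choose! t ht using hex
    refine ⟨t, ht, fun u hu => ⟨?_, (ht u hu).2.1⟩, fun u hu u' hu' h => ?_, fun w hw => ?_⟩
    · exact CritSob.H1g_congr (fun x _ => by simp) (CritSob.add_mem_H1g
        continuousOn_const hg_cont (CritSob.smul_mem_H1g (t u) hu.1) hv.1)
    · have h1 : t u • u = t u' • u' := add_right_cancel h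
      have h2 := congrArg CritSob.critNorm h1
      rw [CritSob.critNorm_smul, CritSob.critNorm_smul, hu.2, hu'.2, mul_one, mul_one,
        abs_of_pos (ht u hu).1, abs_of_pos (ht u' hu').1,
        ENNReal.ofReal_eq_ofReal_iff (ht u hu).1.le (ht u' hu').1.le] at h2
      rw [← h2] at h1
      exact smul_right_injective _ (ht u hu).1.ne' h1
    · have hz : w + (-1 : ℝ) • v ∈ CritSob.H1g Ω (fun _ => 0) :=
        CritSob.H1g_congr (fun x _ => by ring) (CritSob.add_mem_H1g (h := fun x => -1 * g x) hg_cont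
          (continuousOn_const.mul hg_cont) hw.1 (CritSob.smul_mem_H1g (-1) hv.1))
      have hzt : CritSob.critNorm (w + (-1 : ℝ) • v) ≠ ⊤ := by
        refine ((CritSob.critNorm_add_le hn _ _).trans_lt ?_).ne
        rw [CritSob.critNorm_smul, hw.2]
        exact ENNReal.add_lt_top.2 ⟨ENNReal.one_lt_top,
          ENNReal.mul_lt_top ENNReal.ofReal_lt_top (hv1.trans ENNReal.one_lt_top)⟩
      have hwz : (w + (-1 : ℝ) • v) + v = w := by
        rw [neg_one_smul, neg_add_cancel_right]
      generalize w + (-1 : ℝ) • v = z at hz hzt hwz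
      have hz0 : CritSob.critNorm z ≠ 0 := fun h => by
        have := CritSob.critNorm_add_le hn z v
        rw [hwz, hw.2, h, zero_add] at this
        exact this.not_gt hv1
      have hc : 0 < (CritSob.critNorm z).toReal := ENNReal.toReal_pos hz0 hzt
      set c := (CritSob.critNorm z).toReal with hcdef
      have hu : c⁻¹ • z ∈ CritSob.SigmaSet Ω (fun _ => 0) := by
        refine ⟨CritSob.H1g_congr (fun x _ => by simp) (CritSob.smul_mem_H1g c⁻¹ hz), ?_⟩
        rw [CritSob.critNorm_smul, abs_of_pos (inv_pos.2 hc), ← ENNReal.ofReal_toReal hzt, ← hcdef,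
          ← ENNReal.ofReal_mul (inv_pos.2 hc).le, inv_mul_cancel₀ hc.ne', ENNReal.ofReal_one]
      have hcu : c • c⁻¹ • z + v = w := by rw [smul_inv_smul₀ hc.ne', hwz]
      refine ⟨_, hu, ?_⟩
      have htc : c = t (c⁻¹ • z) := (ht _ hu).2.2 c hc (by rw [hcu, hw.2])
      dsimp only
      rw [← htc, hcu]
  · obtain ⟨M, hM⟩ := hF.exists_bound_of_continuousOn hg_cont
    obtain ⟨w, hw, hw1⟩ := CritSob.exists_mem_H1g_critNorm_lt_one hn hΩ.isOpen hΩ.isBounded hM hv.1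
    exact CritSob.sigmaSet_nonempty hn hΩ.isOpen hΩ.isConnected.nonempty hg_cont hw hw1
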